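/- **Game.** Let $A^1,A^2$ be nonempty finite sets of actions and $S^1,S^2$ finite sets of signals. Put $H_n=(A^1\times A^2)^n$, $H=\bigcup_{n\ge 0}H_n$ and $\widetilde H=(A^1\times A^2)^{\mathbb N}$. An *incomplete-information Pursuit-Evasion Game* $G$ is given by a daily payoff function $f:H\to[0,\infty)$ and, for each $h\in H$, probability distributions $p^1_h\in\Delta(S^1)$ and $p^2_h\in\Delta(S^2)$. Its payoff function is $\rho:\widetilde H\to[0,\infty]$, $\rho(h)=\sum_{n=0}^\infty f(h_n)$, where $h_n$ is the prefix of $h$ of length $n$. The game is *bounded* if there is a real $B$ with $\rho(h)<B$ for all $h\in\widetilde H$. A (behavioral) *strategy* of player $i$ is a function $\sigma^i:\bigcup_{n\ge0}(A^i\times S^i)^n\to\Delta(A^i)$. The game is played in stages $n=0,1,2,\dots$. At stage $n$, with current history $h_n$ (and $h_0=\emptyset$), the players draw actions $a\in A^1$ and $b\in A^2$ independently, each according to his strategy at the sequence of his own past actions and signals. The history becomes $h_{n+1}=h_n\frown(a,b)$. A signal pair $(s^1,s^2)$ is then drawn with law $p^1_{h_{n+1}}\times p^2_{h_{n+1}}$,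 and player $i$ observes $s^i$ only. A profile $(\sigma^1,\sigma^2)$ thus induces a probability measure $\mu_{\sigma^1,\sigma^2}$ on $\widetilde H$. Player 1, the Maximizer, wants to maximize the expectation of $\rho$; player 2, the Minimizer, wants to minimize it. **Values.** Put $\mathrm{val}_G(\sigma^1)=\inf_{\sigma^2}E_{\mu_{\sigma^1,\sigma^2}}(\rho)$ and $\mathrm{val}_G(\sigma^2)=\sup_{\sigma^1}E_{\mu_{\sigma^1,\sigma^2}}(\rho)$. The game has the *value* $\mathrm{val}(G)$ if $\sup_{\sigma^1}\mathrm{val}_G(\sigma^1)=\inf_{\sigma^2}\mathrm{val}_G(\sigma^2)=\mathrm{val}(G)$. In a game with a value, a strategy $\sigma^i$ is *$\epsilon$-optimal* if $|\mathrm{val}_G(\sigma^i)-\mathrm{val}(G)|<\epsilon$, and *optimal* if $\mathrm{val}_G(\sigma^i)=\mathrm{val}(G)$. Let $G_n$ be the game obtained from $G$ by replacing $f$ by $0$ at all histories of length larger than $n$. The game $G$ has a *uniform value* if it has a value and for each $\epsilon>0$ there exist $N$ and strategies $\sigma^1,\sigma^2$ of the two players such that, for every $n>N$, the game $G_n$ has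 a value and both $\sigma^1$ and $\sigma^2$ are $\epsilon$-optimal in $G_n$. **Theorem 1.** Every bounded incomplete-information Pursuit-Evasion Game with finite action sets and finite signal sets has a uniform value. Furthermore, the Minimizer has an optimal strategy in $G$. -/

import Mathlib

open MeasureTheory ProbabilityTheory
open scoped NNReal ENNReal

noncomputable section

namespace PursuitEvasion

/-- The data of a two-player zero-sum cumulative game with incomplete information and
nonnegative daily payoffs. Player 1 is the Maximizer, with actions `A₁` and signals `S₁`;
player 2 is the Minimizer, with actions `A₂` and signals `S₂`. A history of length `n` is an
element of `Fin n → A₁ × A₂`. -/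
structure Game (A₁ A₂ S₁ S₂ : Type*) where
  /-- the nonnegative daily payoff attached to every finite history -/
  payoff : (n : ℕ) → (Fin n → A₁ × A₂) → ℝ≥0
  /-- the law of the signal sent to the Maximizer when the current history is `h` -/
  signal₁ : (n : ℕ) → (Fin n → A₁ × A₂) → PMF S₁
  /-- the law of the signal sent to the Minimizer when the current history is `h` -/
  signal₂ : (n : ℕ) → (Fin n → A₁ × A₂) → PMF S₂

/-- Behavioral strategies of a player with actions `A` and signals `S`: a mixed action for each
finite private history, that is, for each finite sequence of own actions and own signals. -/
abbrev Strategy (A S : Type*) := (n : ℕ) → (Fin n → A × S) → PMF A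

namespace Game

variable {A₁ A₂ S₁ S₂ : Type*}

/-- The payoff `ρ(h) = ∑ₙ f(hₙ)` of an infinite history, `hₙ` being its prefix of length `n`. -/
def totalPayoff (G : Game A₁ A₂ S₁ S₂) (h : ℕ → A₁ × A₂) : ℝ≥0∞ :=
  ∑' n : ℕ, (G.payoff n (fun i : Fin n => h i) : ℝ≥0∞)

/-- The game is bounded if its payoff function is. -/
def Bounded (G : Game A₁ A₂ S₁ S₂) : Prop :=
  ∃ B : ℝ≥0, ∀ h : ℕ → A₁ × A₂, G.totalPayoff h < B

/-- The truncated game `Gₙ`: daily payoffs at histories of length larger than `n` are replaced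
by zero. -/
def truncate (G : Game A₁ A₂ S₁ S₂) (n : ℕ) : Game A₁ A₂ S₁ S₂ where
  payoff k h := if k ≤ n then G.payoff k h else 0
  signal₁ := G.signal₁
  signal₂ := G.signal₂

/-- The law of the actions and signals of stage `n`, given all actions and signals of the
stages before `n`: the players draw actions `a`, `b` independently according to their private
histories, the history is extended by `(a, b)`, and then the signals are drawn independently,
with laws determined by the extended history. -/
def stageLaw (G : Game A₁ A₂ S₁ S₂) (σ : Strategy A₁ S₁) (τ : Strategy A₂ S₂) (n : ℕ)
    (x : Fin n → (A₁ × S₁) × (A₂ × S₂)) : PMF ((A₁ × S₁) × (A₂ × S₂)) :=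
  (σ n fun i => (x i).1).bind fun a =>
  (τ n fun i => (x i).2).bind fun b =>
  (G.signal₁ (n + 1)
    (Fin.snoc (α := fun _ => A₁ × A₂) (fun i => ((x i).1.1, (x i).2.1)) (a, b))).bind fun s =>
  (G.signal₂ (n + 1)
    (Fin.snoc (α := fun _ => A₁ × A₂) (fun i => ((x i).1.1, (x i).2.1)) (a, b))).bind fun t =>
  PMF.pure ((a, s), (b, t))

variable [Finite A₁] [Finite A₂] [Finite S₁] [Finite S₂]
  [MeasurableSpace A₁] [MeasurableSpace A₂] [MeasurableSpace S₁] [MeasurableSpace S₂]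
  [DiscreteMeasurableSpace A₁] [DiscreteMeasurableSpace A₂]
  [DiscreteMeasurableSpace S₁] [DiscreteMeasurableSpace S₂]

/-- The transition kernel from the stages `0, …, n` to the stage `n + 1`. -/
def stageKernel (G : Game A₁ A₂ S₁ S₂) (σ : Strategy A₁ S₁) (τ : Strategy A₂ S₂) (n : ℕ) :
    Kernel ((i : Finset.Iic n) → (A₁ × S₁) × (A₂ × S₂)) ((A₁ × S₁) × (A₂ × S₂)) :=
  Kernel.ofFunOfCountable fun x =>
    (G.stageLaw σ τ (n + 1) fun i =>
      x ⟨(i : ℕ), Finset.mem_Iic.2 (Nat.lt_succ_iff.1 i.isLt)⟩).toMeasure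

instance (G : Game A₁ A₂ S₁ S₂) (σ : Strategy A₁ S₁) (τ : Strategy A₂ S₂) (n : ℕ) :
    IsMarkovKernel (G.stageKernel σ τ n) :=
  ⟨fun _ => PMF.toMeasure.isProbabilityMeasure _⟩

/-- The law of the whole play (all actions and all signals) under a profile. -/
def playMeasure (G : Game A₁ A₂ S₁ S₂) (σ : Strategy A₁ S₁) (τ : Strategy A₂ S₂) :
    Measure (ℕ → (A₁ × S₁) × (A₂ × S₂)) :=
  Kernel.trajMeasure (X := fun _ => (A₁ × S₁) × (A₂ × S₂))
    (G.stageLaw σ τ 0 Fin.elim0).toMeasure (G.stageKernel σ τ)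

/-- The law of the infinite history (all actions) under a profile. -/
def historyMeasure (G : Game A₁ A₂ S₁ S₂) (σ : Strategy A₁ S₁) (τ : Strategy A₂ S₂) :
    Measure (ℕ → A₁ × A₂) :=
  (G.playMeasure σ τ).map fun x n => ((x n).1.1, (x n).2.1)

/-- The expected payoff under a profile. -/
def expectedPayoff (G : Game A₁ A₂ S₁ S₂) (σ : Strategy A₁ S₁) (τ : Strategy A₂ S₂) : ℝ≥0∞ :=
  ∫⁻ h, G.totalPayoff h ∂(G.historyMeasure σ τ)

/-- The value of a strategy of the Maximizer. -/
def val₁ (G : Game A₁ A₂ S₁ S₂) (σ : Strategy A₁ S₁) : ℝ≥0∞ :=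
  ⨅ τ : Strategy A₂ S₂, G.expectedPayoff σ τ

/-- The value of a strategy of the Minimizer. -/
def val₂ (G : Game A₁ A₂ S₁ S₂) (τ : Strategy A₂ S₂) : ℝ≥0∞ :=
  ⨆ σ : Strategy A₁ S₁, G.expectedPayoff σ τ

/-- The lower value of the game. -/
def lowerValue (G : Game A₁ A₂ S₁ S₂) : ℝ≥0∞ := ⨆ σ : Strategy A₁ S₁, G.val₁ σ

/-- The upper value of the game. -/
def upperValue (G : Game A₁ A₂ S₁ S₂) : ℝ≥0∞ := ⨅ τ : Strategy A₂ S₂, G.val₂ τ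

/-- `v` is the value of the game: the lower and the upper value both equal `v`. -/
def IsValue (G : Game A₁ A₂ S₁ S₂) (v : ℝ≥0∞) : Prop := G.lowerValue = v ∧ G.upperValue = v

/-- `σ` is an `ε`-optimal strategy of the Maximizer: the game has a value `v`, and
`|val(σ) - v| < ε`. (The absolute value is spelled out because the numbers are in `[0, ∞]`.) -/
def IsEpsOptimal₁ (G : Game A₁ A₂ S₁ S₂) (ε : ℝ≥0) (σ : Strategy A₁ S₁) : Prop :=
  ∃ v, G.IsValue v ∧ G.val₁ σ < v + ε ∧ v < G.val₁ σ + ε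

/-- `τ` is an `ε`-optimal strategy of the Minimizer: the game has a value `v`, and
`|val(τ) - v| < ε`. -/
def IsEpsOptimal₂ (G : Game A₁ A₂ S₁ S₂) (ε : ℝ≥0) (τ : Strategy A₂ S₂) : Prop :=
  ∃ v, G.IsValue v ∧ G.val₂ τ < v + ε ∧ v < G.val₂ τ + ε

/-- `τ` is an optimal strategy of the Minimizer: the game has a value, and `val(τ)` equals it. -/
def IsOptimal₂ (G : Game A₁ A₂ S₁ S₂) (τ : Strategy A₂ S₂) : Prop := G.IsValue (G.val₂ τ)

/-- The game has a uniform value: it has a value, and for each `ε > 0` there are `N` and two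
strategies that are `ε`-optimal in every truncated game `Gₙ` with `n > N`. -/
def HasUniformValue (G : Game A₁ A₂ S₁ S₂) : Prop :=
  (∃ v, G.IsValue v) ∧
  ∀ ε : ℝ≥0, 0 < ε → ∃ (N : ℕ) (σ : Strategy A₁ S₁) (τ : Strategy A₂ S₂),
    ∀ n > N, (G.truncate n).IsEpsOptimal₁ ε σ ∧ (G.truncate n).IsEpsOptimal₂ ε τ

end Game

end PursuitEvasion

end

/-! The probability of a finite play factors into a product depending on the Maximizer's strategy,
one depending on the Minimizer's, and signal probabilities. A strategy therefore matters only
through its realization weights, and these form a compact convex set, `plans`. The expected payoff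
of a truncated game is continuous and bilinear in the two plans (`expectedPayoff_truncate`), so
Sion's theorem gives a value `u n` and optimal strategies for each truncation
(`exists_saddle_truncate`).

Let `v` be the supremum of the `u n`; boundedness makes it finite. As payoffs are nonnegative, a
Maximizer strategy optimal in the `N`-th truncation still guarantees `u N` in every longer one and
in `G`. For the Minimizer, the plans guaranteeing `v` in the `n`-th truncation form a decreasing
sequence of nonempty compact sets; a common point guarantees `v` in all truncations
(`exists_uniform_strategy₂`), hence in `G` by monotone convergence. Thus `v` is the value, and that
strategy is optimal. -/

noncomputable section

namespace PursuitEvasion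

/-! ### Realization plans: correspondence with strategies, compactness, convexity -/

section Plans

variable {A S : Type*}

/-- The realization weight of a private history under a strategy: the product of the
probabilities with which the strategy chooses the actions of the history. -/
def weight (σ : Strategy A S) : (n : ℕ) → (Fin n → A × S) → ℝ
  | 0, _ => 1
  | n + 1, h => weight σ n (Fin.init h) * (σ n (Fin.init h) (h (Fin.last n)).1).toReal

/-- The private history `h` followed by the action `a` and the signal `s`. -/
def extend {n : ℕ} (h : Fin n → A × S) (a : A) (s : S) : Fin (n + 1) → A × S :=
  Fin.snoc (α := fun _ => A × S) h (a, s)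

lemma extend_init_last {n : ℕ} (h : Fin (n + 1) → A × S) :
    extend (Fin.init h) (h (Fin.last n)).1 (h (Fin.last n)).2 = h :=
  Fin.snoc_init_self (α := fun _ => A × S) h

lemma weight_extend (σ : Strategy A S) {n : ℕ} (h : Fin n → A × S) (a : A) (s : S) :
    weight σ (n + 1) (extend h a s) = weight σ n h * (σ n h a).toReal := by
  simp [weight, extend]

variable (A S) in
/-- The realization plans: the families of weights of private histories which satisfy the
linear constraints of the sequence form. -/
def plans [Fintype A] : Set ((n : ℕ) → (Fin n → A × S) → ℝ) :=
  {w | (∀ n h, 0 ≤ w n h) ∧ (∀ h, w 0 h = 1) ∧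
    (∀ n h s, ∑ a, w (n + 1) (extend h a s) = w n h) ∧
    ∀ n h a s s', w (n + 1) (extend h a s) = w (n + 1) (extend h a s')}

lemma weight_nonneg (σ : Strategy A S) (n : ℕ) (h : Fin n → A × S) : 0 ≤ weight σ n h := by
  induction n with
  | zero => simp [weight]
  | succ n ih => exact mul_nonneg (ih _) ENNReal.toReal_nonneg

lemma sum_toReal_pmf [Fintype A] (p : PMF A) : ∑ a, (p a).toReal = 1 := by
  rw [← ENNReal.toReal_sum fun a _ => p.apply_ne_top a, ← tsum_fintype (L := .unconditional A),
    p.tsum_coe, ENNReal.toReal_one]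

lemma weight_mem_plans [Fintype A] (σ : Strategy A S) : weight σ ∈ plans A S := by
  refine ⟨weight_nonneg σ, fun h => rfl, fun n h s => ?_, fun n h a s s' => ?_⟩
  · simp_rw [weight_extend, ← Finset.mul_sum, sum_toReal_pmf, mul_one]
  · simp_rw [weight_extend]

lemma exists_pmf_toReal_eq [Fintype A] (f : A → ℝ) (hf : ∀ a, 0 ≤ f a) (hs : ∑ a, f a = 1) :
    ∃ p : PMF A, ∀ a, (p a).toReal = f a := by
  refine ⟨PMF.ofFintype (fun a => ENNReal.ofReal (f a)) ?_, fun a => ?_⟩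
  · rw [← ENNReal.ofReal_sum_of_nonneg fun a _ => hf a, hs, ENNReal.ofReal_one]
  · simp [hf a]

/-- Every realization plan is the family of realization weights of a behavioral strategy. -/
lemma exists_weight_eq [Fintype A] [Nonempty A] [Nonempty S]
    {w : (n : ℕ) → (Fin n → A × S) → ℝ} (hw : w ∈ plans A S) :
    ∃ σ : Strategy A S, weight σ = w := by
  obtain ⟨h0, h1, h2, h3⟩ := hw
  have key : ∀ n (h : Fin n → A × S), ∃ p : PMF A, ∀ a s,
      w (n + 1) (extend h a s) = w n h * (p a).toReal := by
    intro n h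
    obtain ⟨s₀⟩ := ‹Nonempty S›
    by_cases hz : w n h = 0
    -- A history of weight zero is never reached: its extensions also have weight zero, so any mixed
    -- action serves.
    · refine ⟨PMF.pure (Classical.arbitrary A), fun a s => ?_⟩
      have := (Finset.sum_eq_zero_iff_of_nonneg fun a _ => h0 _ _).1 ((h2 n h s).trans hz) a
        (Finset.mem_univ a)
      simp [hz, this]
    -- Otherwise take conditional probabilities. The signal `s₀` is immaterial, since the weights of
    -- a plan do not depend on the last signal.
    · obtain ⟨p, hp⟩ := exists_pmf_toReal_eq (fun a => w (n + 1) (extend h a s₀) / w n h)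
        (fun a => div_nonneg (h0 _ _) (h0 _ _))
        (by rw [← Finset.sum_div, h2, div_self hz])
      refine ⟨p, fun a s => ?_⟩
      rw [hp, mul_div_cancel₀ _ hz, h3 n h a s s₀]
  choose σ hσ using key
  refine ⟨σ, ?_⟩
  funext n
  induction n with
  | zero => funext h; simp [weight, h1]
  | succ n ih =>
    funext h
    rw [← extend_init_last h, weight_extend, hσ, ih]

lemma le_one_of_mem_plans [Fintype A] {w : (n : ℕ) → (Fin n → A × S) → ℝ} (hw : w ∈ plans A S)
    (n : ℕ) (h : Fin n → A × S) : w n h ≤ 1 := by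
  obtain ⟨h0, h1, h2, -⟩ := hw
  induction n with
  | zero => exact (h1 h).le
  | succ n ih =>
    refine le_trans ?_ (ih (Fin.init h))
    rw [← h2 n _ (h (Fin.last n)).2]
    conv_lhs => rw [← extend_init_last h]
    exact Finset.single_le_sum
      (f := fun a => w (n + 1) (extend (Fin.init h) a (h (Fin.last n)).2))
      (fun a _ => h0 _ _) (Finset.mem_univ _)

lemma isClosed_plans [Fintype A] : IsClosed (plans A S) := by
  simp only [plans, Set.ofPred_and, Set.ofPred_forall]
  refine ((isClosed_iInter fun n => isClosed_iInter fun h => ?_).inter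
    ((isClosed_iInter fun h => ?_).inter
    ((isClosed_iInter fun n => isClosed_iInter fun h => isClosed_iInter fun s => ?_).inter
    (isClosed_iInter fun n => isClosed_iInter fun h => isClosed_iInter fun a =>
      isClosed_iInter fun s => isClosed_iInter fun s' => ?_))))
  · exact isClosed_le (by fun_prop) (by fun_prop)
  all_goals exact isClosed_eq (by fun_prop) (by fun_prop)

/-- By Tychonoff: plans form a closed subset of a product of unit intervals, in the topology of
pointwise convergence. -/
lemma isCompact_plans [Fintype A] : IsCompact (plans A S) := by
  refine (isCompact_univ_pi (s := fun n => Set.univ.pi fun _ => Set.Icc (0 : ℝ) 1)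
    fun n => isCompact_univ_pi fun h => isCompact_Icc).of_isClosed_subset isClosed_plans ?_
  exact fun w hw n _ h _ => ⟨hw.1 n h, le_one_of_mem_plans hw n h⟩

lemma convex_plans [Fintype A] : Convex ℝ (plans A S) := by
  rintro v ⟨v0, v1, v2, v3⟩ w ⟨w0, w1, w2, w3⟩ a b ha hb hab
  refine ⟨fun n h => ?_, fun h => ?_, fun n h s => ?_, fun n h c s s' => ?_⟩
  · exact add_nonneg (mul_nonneg ha (v0 n h)) (mul_nonneg hb (w0 n h))
  · simp [v1, w1, hab]
  · simp [Finset.sum_add_distrib, ← Finset.mul_sum, v2, w2]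
  · simp [v3 n h c s s', w3 n h c s s']

lemma plans_nonempty [Fintype A] [Nonempty A] : (plans A S).Nonempty :=
  ⟨_, weight_mem_plans fun _ _ => PMF.pure (Classical.arbitrary A)⟩

end Plans

/-! ### Stage payoffs as bilinear forms in the plans, and their minimax theorem -/

namespace Game

variable {A₁ A₂ S₁ S₂ : Type*}

/-- The actions of a finite sequence of stages. -/
def actions {n : ℕ} (x : Fin n → (A₁ × S₁) × (A₂ × S₂)) : Fin n → A₁ × A₂ :=
  fun i => ((x i).1.1, (x i).2.1)

/-- The product of the probabilities of the signals of a finite sequence of stages. -/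
def signalWeight (G : Game A₁ A₂ S₁ S₂) : (n : ℕ) → (Fin n → (A₁ × S₁) × (A₂ × S₂)) → ℝ
  | 0, _ => 1
  | n + 1, x => signalWeight G n (Fin.init x) *
      ((G.signal₁ (n + 1) (actions x) (x (Fin.last n)).1.2).toReal *
        (G.signal₂ (n + 1) (actions x) (x (Fin.last n)).2.2).toReal)

lemma signalWeight_nonneg (G : Game A₁ A₂ S₁ S₂) (n : ℕ)
    (x : Fin n → (A₁ × S₁) × (A₂ × S₂)) : 0 ≤ G.signalWeight n x := by
  induction n with
  | zero => simp [signalWeight]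
  | succ n ih =>
    exact mul_nonneg (ih _) (mul_nonneg ENNReal.toReal_nonneg ENNReal.toReal_nonneg)

lemma stageLaw_apply (G : Game A₁ A₂ S₁ S₂) (σ : Strategy A₁ S₁) (τ : Strategy A₂ S₂) (n : ℕ)
    (x : Fin (n + 1) → (A₁ × S₁) × (A₂ × S₂)) :
    G.stageLaw σ τ n (Fin.init x) (x (Fin.last n)) =
      σ n (fun i => (Fin.init x i).1) (x (Fin.last n)).1.1 *
      (τ n (fun i => (Fin.init x i).2) (x (Fin.last n)).2.1 *
      (G.signal₁ (n + 1) (actions x) (x (Fin.last n)).1.2 *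
        G.signal₂ (n + 1) (actions x) (x (Fin.last n)).2.2)) := by
  classical
  have hx : (Fin.snoc (α := fun _ => A₁ × A₂)
      (fun i => ((Fin.init x i).1.1, (Fin.init x i).2.1))
      ((x (Fin.last n)).1.1, (x (Fin.last n)).2.1) : Fin (n + 1) → A₁ × A₂) = actions x :=
    Fin.snoc_init_self (α := fun _ => A₁ × A₂) (actions x)
  generalize hz : x (Fin.last n) = z at *
  obtain ⟨⟨a, s⟩, b, t⟩ := z
  simp only at hx
  simp only [stageLaw, PMF.bind_apply, PMF.pure_apply, Prod.mk.injEq]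
  rw [tsum_eq_single a, tsum_eq_single b, tsum_eq_single s, tsum_eq_single t]
  · rw [hx]; simp
  · intro t' ht; simp [ht.symm]
  · intro s' hs; simp [hs.symm]
  · intro b' hb; simp [hb.symm]
  · intro a' ha; simp [ha.symm]

section Fintype

variable [Fintype A₁] [Fintype A₂] [Fintype S₁] [Fintype S₂]

/-- The expected payoff of stage `k` as a bilinear function of the realization plans. -/
def planPayoff (G : Game A₁ A₂ S₁ S₂) (k : ℕ) (v : (n : ℕ) → (Fin n → A₁ × S₁) → ℝ)
    (w : (n : ℕ) → (Fin n → A₂ × S₂) → ℝ) : ℝ :=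
  ∑ x : Fin k → (A₁ × S₁) × (A₂ × S₂), G.payoff k (actions x) *
    (v k (fun i => (x i).1) * w k (fun i => (x i).2) * G.signalWeight k x)

lemma planPayoff_nonneg (G : Game A₁ A₂ S₁ S₂) (k : ℕ)
    {v : (n : ℕ) → (Fin n → A₁ × S₁) → ℝ} {w : (n : ℕ) → (Fin n → A₂ × S₂) → ℝ}
    (hv : v ∈ plans A₁ S₁) (hw : w ∈ plans A₂ S₂) : 0 ≤ G.planPayoff k v w :=
  Finset.sum_nonneg fun x _ => mul_nonneg (NNReal.coe_nonneg _)
    (mul_nonneg (mul_nonneg (hv.1 _ _) (hw.1 _ _)) (G.signalWeight_nonneg k x))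

/-- The expected payoff of the stages `0, …, n` as a function of the realization plans. -/
def planSum (G : Game A₁ A₂ S₁ S₂) (n : ℕ) (v : (n : ℕ) → (Fin n → A₁ × S₁) → ℝ)
    (w : (n : ℕ) → (Fin n → A₂ × S₂) → ℝ) : ℝ :=
  ∑ k ∈ Finset.range (n + 1), G.planPayoff k v w

lemma continuous_planSum_left (G : Game A₁ A₂ S₁ S₂) (n : ℕ)
    (w : (n : ℕ) → (Fin n → A₂ × S₂) → ℝ) : Continuous fun v => G.planSum n v w := by
  unfold planSum planPayoff
  fun_prop

lemma continuous_planSum_right (G : Game A₁ A₂ S₁ S₂) (n : ℕ)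
    (v : (n : ℕ) → (Fin n → A₁ × S₁) → ℝ) : Continuous fun w => G.planSum n v w := by
  unfold planSum planPayoff
  fun_prop

lemma planSum_combo_left (G : Game A₁ A₂ S₁ S₂) (n : ℕ) (a b : ℝ)
    (v v' : (n : ℕ) → (Fin n → A₁ × S₁) → ℝ) (w : (n : ℕ) → (Fin n → A₂ × S₂) → ℝ) :
    G.planSum n (a • v + b • v') w = a • G.planSum n v w + b • G.planSum n v' w := by
  simp only [planSum, planPayoff, Pi.add_apply, Pi.smul_apply, smul_eq_mul, Finset.mul_sum]
  simp only [← Finset.sum_add_distrib]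
  exact Finset.sum_congr rfl fun k _ => Finset.sum_congr rfl fun x _ => by ring

lemma planSum_combo_right (G : Game A₁ A₂ S₁ S₂) (n : ℕ) (a b : ℝ)
    (v : (n : ℕ) → (Fin n → A₁ × S₁) → ℝ) (w w' : (n : ℕ) → (Fin n → A₂ × S₂) → ℝ) :
    G.planSum n v (a • w + b • w') = a • G.planSum n v w + b • G.planSum n v w' := by
  simp only [planSum, planPayoff, Pi.add_apply, Pi.smul_apply, smul_eq_mul, Finset.mul_sum]
  simp only [← Finset.sum_add_distrib]
  exact Finset.sum_congr rfl fun k _ => Finset.sum_congr rfl fun x _ => by ring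

/-- The minimax theorem for the truncated games, in terms of realization plans. -/
lemma exists_saddle_planSum [Nonempty A₁] [Nonempty A₂] (G : Game A₁ A₂ S₁ S₂) (n : ℕ) :
    ∃ w ∈ plans A₂ S₂, ∃ v ∈ plans A₁ S₁,
      IsSaddlePointOn (plans A₂ S₂) (plans A₁ S₁) (fun w v => G.planSum n v w) w v := by
  refine Sion.exists_isSaddlePointOn plans_nonempty convex_plans isCompact_plans
    (fun v _ => (G.continuous_planSum_right n v).lowerSemicontinuous.lowerSemicontinuousOn _)
    (fun v _ => ConvexOn.quasiconvexOn ⟨convex_plans, ?_⟩)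
    convex_plans plans_nonempty isCompact_plans
    (fun w _ => (G.continuous_planSum_left n w).upperSemicontinuous.upperSemicontinuousOn _)
    (fun w _ => ConcaveOn.quasiconcaveOn ⟨convex_plans, ?_⟩)
  · exact fun w _ w' _ a b _ _ _ => (G.planSum_combo_right n a b v w w').le
  · exact fun v _ v' _ a b _ _ _ => (G.planSum_combo_left n a b v v' w).ge

end Fintype

lemma truncate_payoff (G : Game A₁ A₂ S₁ S₂) (n k : ℕ) (h : Fin k → A₁ × A₂) :
    (G.truncate n).payoff k h = if k ≤ n then G.payoff k h else 0 := rfl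

/-! ### The law of the play and the expected payoff in terms of plans -/

section Play

variable [Fintype A₁] [Fintype A₂] [Fintype S₁] [Fintype S₂]
  [MeasurableSpace A₁] [MeasurableSpace A₂] [MeasurableSpace S₁] [MeasurableSpace S₂]
  [DiscreteMeasurableSpace A₁] [DiscreteMeasurableSpace A₂]
  [DiscreteMeasurableSpace S₁] [DiscreteMeasurableSpace S₂]

lemma playMeasure_map_frestrictLe_zero (G : Game A₁ A₂ S₁ S₂) (σ : Strategy A₁ S₁)
    (τ : Strategy A₂ S₂) : (G.playMeasure σ τ).map (Preorder.frestrictLe 0) =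
      (G.stageLaw σ τ 0 Fin.elim0).toMeasure.map (MeasurableEquiv.piUnique _).symm := by
  rw [playMeasure, Kernel.trajMeasure, Measure.map_comp _ _ (by fun_prop),
    Kernel.traj_map_frestrictLe, Kernel.partialTraj_self, Measure.id_comp]

/-- The probability that the play starts with a given finite sequence of stages, as the product
of the transition probabilities. -/
lemma playMeasure_cylinder_succ (G : Game A₁ A₂ S₁ S₂) (σ : Strategy A₁ S₁)
    (τ : Strategy A₂ S₂) (n : ℕ) (x : Fin (n + 1) → (A₁ × S₁) × (A₂ × S₂)) :
    G.playMeasure σ τ {y | ∀ i : Fin (n + 1), y i = x i} =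
      G.playMeasure σ τ {y | ∀ i : Fin n, y i = Fin.init x i} *
        G.stageLaw σ τ n (Fin.init x) (x (Fin.last n)) := by
  cases n with
  | zero =>
    -- Stage `0` is drawn from the initial law and not from a kernel, so it is treated separately.
    have h0 : {y : ℕ → (A₁ × S₁) × (A₂ × S₂) | ∀ i : Fin 1, y i = x i} =
        Preorder.frestrictLe 0 ⁻¹'
          ((fun z : (i : Finset.Iic 0) → (A₁ × S₁) × (A₂ × S₂) =>
            z ⟨0, by simp⟩) ⁻¹' {x (Fin.last 0)}) := by
      ext y
      simp [Fin.forall_fin_one, Preorder.frestrictLe]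
    have h1 : {y : ℕ → (A₁ × S₁) × (A₂ × S₂) | ∀ i : Fin 0, y i = Fin.init x i} = Set.univ := by
      ext y; simp
    have hm : IsProbabilityMeasure (G.playMeasure σ τ) := by
      unfold playMeasure; infer_instance
    rw [h1, measure_univ, one_mul, h0, ← Measure.map_apply (by fun_prop) (.of_discrete),
      playMeasure_map_frestrictLe_zero, Measure.map_apply (by fun_prop) (.of_discrete)]
    have h2 : (Fin.init x : Fin 0 → (A₁ × S₁) × (A₂ × S₂)) = Fin.elim0 := Subsingleton.elim _ _
    rw [h2, ← PMF.toMeasure_apply_singleton _ _ (.singleton _)]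
    congr 1
  | succ n =>
    set r : (i : Finset.Iic n) → (A₁ × S₁) × (A₂ × S₂) :=
      fun i => x ⟨i, by have := Finset.mem_Iic.1 i.2; omega⟩ with hr
    have h0 : {y : ℕ → (A₁ × S₁) × (A₂ × S₂) | ∀ i : Fin (n + 1), y i = Fin.init x i} =
        Preorder.frestrictLe (π := fun _ => (A₁ × S₁) × (A₂ × S₂)) n ⁻¹' {r} := by
      ext y
      simp only [Set.mem_ofPred_eq, Set.mem_preimage, Set.mem_singleton_iff, funext_iff,
        Subtype.forall, Finset.mem_Iic, Fin.forall_iff, hr, Preorder.frestrictLe_apply, Fin.init]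
      exact ⟨fun h i hi => h i (by omega), fun h i hi => h i (by omega)⟩
    have h1 : {y : ℕ → (A₁ × S₁) × (A₂ × S₂) | ∀ i : Fin (n + 1 + 1), y i = x i} =
        (fun y => (Preorder.frestrictLe (π := fun _ => (A₁ × S₁) × (A₂ × S₂)) n y, y (n + 1))) ⁻¹'
          ({r} ×ˢ {x (Fin.last (n + 1))}) := by
      have h2 : {y : ℕ → (A₁ × S₁) × (A₂ × S₂) | ∀ i : Fin (n + 1 + 1), y i = x i} =
          {y | ∀ i : Fin (n + 1), y i = Fin.init x i} ∩ {y | y (n + 1) = x (Fin.last (n + 1))} := by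
        ext y
        simp [Fin.forall_fin_succ', Fin.init]
      rw [h2, h0]
      rfl
    have hk : (G.stageKernel σ τ n r) {x (Fin.last (n + 1))} =
        G.stageLaw σ τ (n + 1) (Fin.init x) (x (Fin.last (n + 1))) := by
      rw [← PMF.toMeasure_apply_singleton _ _ (.singleton _)]
      rfl
    rw [h1, h0, ← hk,
      ← Measure.map_apply (by fun_prop) ((MeasurableSet.singleton _).prod (.singleton _)),
      ← Measure.map_apply (by fun_prop) (.singleton _)]
    -- The joint law of the stages up to `n` and of stage `n + 1` is the composition-product with
    -- the stage kernel; on a rectangle of two singletons it is a product.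
    have := Kernel.map_frestrictLe_trajMeasure_compProd_eq_map_trajMeasure
      (X := fun _ => (A₁ × S₁) × (A₂ × S₂))
      (μ₀ := (G.stageLaw σ τ 0 Fin.elim0).toMeasure) (κ := G.stageKernel σ τ) (a := n)
    rw [playMeasure, ← this, Measure.compProd_apply_prod (.singleton _) (.singleton _),
      Measure.restrict_singleton, lintegral_smul_measure, lintegral_dirac, smul_eq_mul]

/-- The factorization behind bilinearity: each transition probability splits into a factor for each
player and a signal factor, and these are collected separately along the play. -/
lemma playMeasure_cylinder (G : Game A₁ A₂ S₁ S₂) (σ : Strategy A₁ S₁) (τ : Strategy A₂ S₂)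
    (n : ℕ) (x : Fin n → (A₁ × S₁) × (A₂ × S₂)) :
    G.playMeasure σ τ {y | ∀ i : Fin n, y i = x i} =
      ENNReal.ofReal (weight σ n (fun i => (x i).1) * weight τ n (fun i => (x i).2) *
        G.signalWeight n x) := by
  induction n with
  | zero =>
    have hm : IsProbabilityMeasure (G.playMeasure σ τ) := by
      unfold playMeasure; infer_instance
    simp [weight, signalWeight]
  | succ n ih =>
    have e₁ := weight_nonneg σ n fun i => (Fin.init x i).1
    have e₂ := weight_nonneg τ n fun i => (Fin.init x i).2
    have e₃ := G.signalWeight_nonneg n (Fin.init x)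
    rw [playMeasure_cylinder_succ, ih, stageLaw_apply,
      ← ENNReal.ofReal_toReal ((σ n fun i => (Fin.init x i).1).apply_ne_top _),
      ← ENNReal.ofReal_toReal ((τ n fun i => (Fin.init x i).2).apply_ne_top _),
      ← ENNReal.ofReal_toReal ((G.signal₁ (n + 1) (actions x)).apply_ne_top _),
      ← ENNReal.ofReal_toReal ((G.signal₂ (n + 1) (actions x)).apply_ne_top _),
      ← ENNReal.ofReal_mul (by positivity), ← ENNReal.ofReal_mul (by positivity),
      ← ENNReal.ofReal_mul (by positivity), ← ENNReal.ofReal_mul (by positivity)]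
    congr 1
    simp only [weight, signalWeight]
    change _ = (weight σ n (fun i => (Fin.init x i).1) *
      (σ n (fun i => (Fin.init x i).1) (x (Fin.last n)).1.1).toReal) *
      (weight τ n (fun i => (Fin.init x i).2) *
      (τ n (fun i => (Fin.init x i).2) (x (Fin.last n)).2.1).toReal) * _
    ring

/-- The integrand depends only on the first `k` stages, so the integral is a finite sum over
cylinders. -/
lemma lintegral_payoff (G : Game A₁ A₂ S₁ S₂) (σ : Strategy A₁ S₁) (τ : Strategy A₂ S₂) (k : ℕ) :
    ∫⁻ h, (G.payoff k (fun i : Fin k => h i) : ℝ≥0∞) ∂(G.historyMeasure σ τ) =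
      ENNReal.ofReal (G.planPayoff k (weight σ) (weight τ)) := by
  have hm : Measurable fun h : ℕ → A₁ × A₂ => (G.payoff k (fun i : Fin k => h i) : ℝ≥0∞) :=
    (measurable_of_countable (fun z : Fin k → A₁ × A₂ => (G.payoff k z : ℝ≥0∞))).comp
      (measurable_pi_lambda _ fun i => measurable_pi_apply _)
  have hr : Measurable fun (y : ℕ → (A₁ × S₁) × (A₂ × S₂)) (i : Fin k) => y i :=
    measurable_pi_lambda _ fun i => measurable_pi_apply _
  rw [historyMeasure, lintegral_map hm (by fun_prop)]
  have hc := lintegral_map (μ := G.playMeasure σ τ) (measurable_of_countable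
    (fun z : Fin k → (A₁ × S₁) × (A₂ × S₂) => (G.payoff k (actions z) : ℝ≥0∞))) hr
  refine hc.symm.trans ?_
  rw [lintegral_fintype, planPayoff, ENNReal.ofReal_sum_of_nonneg]
  · refine Finset.sum_congr rfl fun x _ => ?_
    rw [Measure.map_apply hr (.singleton _), ENNReal.ofReal_mul (NNReal.coe_nonneg _),
      ENNReal.ofReal_coe_nnreal, ← playMeasure_cylinder]
    congr 2
    ext y
    simp [funext_iff]
  · exact fun x _ => mul_nonneg (NNReal.coe_nonneg _) (mul_nonneg
      (mul_nonneg (weight_nonneg _ _ _) (weight_nonneg _ _ _)) (G.signalWeight_nonneg k x))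

lemma expectedPayoff_eq_tsum (G : Game A₁ A₂ S₁ S₂) (σ : Strategy A₁ S₁) (τ : Strategy A₂ S₂) :
    G.expectedPayoff σ τ = ∑' k, ENNReal.ofReal (G.planPayoff k (weight σ) (weight τ)) := by
  simp_rw [← lintegral_payoff]
  refine lintegral_tsum fun k => Measurable.aemeasurable ?_
  exact (measurable_of_countable (fun z : Fin k → A₁ × A₂ => (G.payoff k z : ℝ≥0∞))).comp
    (measurable_pi_lambda _ fun i => measurable_pi_apply _)

lemma expectedPayoff_truncate (G : Game A₁ A₂ S₁ S₂) (n : ℕ) (σ : Strategy A₁ S₁)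
    (τ : Strategy A₂ S₂) :
    (G.truncate n).expectedPayoff σ τ = ENNReal.ofReal (G.planSum n (weight σ) (weight τ)) := by
  have hs (k : ℕ) (x : Fin k → (A₁ × S₁) × (A₂ × S₂)) :
      (G.truncate n).signalWeight k x = G.signalWeight k x := by
    induction k with
    | zero => rfl
    | succ k ih => simp only [signalWeight, ih]; rfl
  rw [expectedPayoff_eq_tsum, planSum, ENNReal.ofReal_sum_of_nonneg fun k _ =>
      G.planPayoff_nonneg k (weight_mem_plans σ) (weight_mem_plans τ),
    tsum_eq_sum (s := Finset.range (n + 1))]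
  · refine Finset.sum_congr rfl fun k hk => ?_
    have : k ≤ n := by simpa [Nat.lt_succ_iff] using hk
    simp [planPayoff, hs, truncate_payoff, this]
  · intro k hk
    have : ¬ k ≤ n := by simpa [Nat.lt_succ_iff] using hk
    simp [planPayoff, truncate_payoff, this]

lemma expectedPayoff_truncate_mono (G : Game A₁ A₂ S₁ S₂) (σ : Strategy A₁ S₁)
    (τ : Strategy A₂ S₂) : Monotone fun n => (G.truncate n).expectedPayoff σ τ := by
  intro m n hmn
  simp only [expectedPayoff_truncate]
  refine ENNReal.ofReal_le_ofReal (Finset.sum_le_sum_of_subset_of_nonneg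
    (Finset.range_subset_range.2 (by omega)) fun k _ _ => ?_)
  exact G.planPayoff_nonneg k (weight_mem_plans σ) (weight_mem_plans τ)

/-- A series of nonnegative terms is the supremum of its partial sums. Truncation at `n` keeps `n +
1` terms, whence the shift by one. -/
lemma expectedPayoff_eq_iSup (G : Game A₁ A₂ S₁ S₂) (σ : Strategy A₁ S₁) (τ : Strategy A₂ S₂) :
    G.expectedPayoff σ τ = ⨆ n, (G.truncate n).expectedPayoff σ τ := by
  simp only [expectedPayoff_truncate]
  rw [expectedPayoff_eq_tsum, ENNReal.tsum_eq_iSup_nat' (Filter.tendsto_add_atTop_nat 1)]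
  exact iSup_congr fun n => (ENNReal.ofReal_sum_of_nonneg fun k _ =>
    G.planPayoff_nonneg k (weight_mem_plans σ) (weight_mem_plans τ)).symm

lemma expectedPayoff_le_of_totalPayoff_lt (G : Game A₁ A₂ S₁ S₂) {B : ℝ≥0}
    (hB : ∀ h, G.totalPayoff h < B) (σ : Strategy A₁ S₁) (τ : Strategy A₂ S₂) : G.expectedPayoff σ τ ≤ B := by
  have hm : IsProbabilityMeasure (G.playMeasure σ τ) := by
    unfold playMeasure; infer_instance
  have hp : IsProbabilityMeasure (G.historyMeasure σ τ) :=
    Measure.isProbabilityMeasure_map (by fun_prop)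
  refine (lintegral_mono fun h => (hB h).le).trans ?_
  simp

end Play

lemma nonempty_signal₁ (G : Game A₁ A₂ S₁ S₂) : Nonempty S₁ :=
  (G.signal₁ 0 Fin.elim0).support_nonempty.to_type

lemma nonempty_signal₂ (G : Game A₁ A₂ S₁ S₂) : Nonempty S₂ :=
  (G.signal₂ 0 Fin.elim0).support_nonempty.to_type

/-! ### Values, and optimal strategies of truncated games -/

section Value

variable [Finite A₁] [Finite A₂] [Finite S₁] [Finite S₂]
  [MeasurableSpace A₁] [MeasurableSpace A₂] [MeasurableSpace S₁] [MeasurableSpace S₂]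
  [DiscreteMeasurableSpace A₁] [DiscreteMeasurableSpace A₂]
  [DiscreteMeasurableSpace S₁] [DiscreteMeasurableSpace S₂]

lemma val₁_le_lowerValue (G : Game A₁ A₂ S₁ S₂) (σ : Strategy A₁ S₁) :
    G.val₁ σ ≤ G.lowerValue :=
  le_iSup G.val₁ σ

lemma upperValue_le_val₂ (G : Game A₁ A₂ S₁ S₂) (τ : Strategy A₂ S₂) :
    G.upperValue ≤ G.val₂ τ :=
  iInf_le G.val₂ τ

/-- Weak duality (sup inf is at most inf sup) supplies the two reverse inequalities. -/
lemma isValue_of_le (G : Game A₁ A₂ S₁ S₂) {v : ℝ≥0∞} (h₁ : v ≤ G.lowerValue)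
    (h₂ : G.upperValue ≤ v) : G.IsValue v := by
  have h : G.lowerValue ≤ G.upperValue := iSup_iInf_le_iInf_iSup G.expectedPayoff
  exact ⟨(h.trans h₂).antisymm h₁, h₂.antisymm (h₁.trans h)⟩

end Value

section Minimax

variable [Fintype A₁] [Fintype A₂] [Fintype S₁] [Fintype S₂]
  [MeasurableSpace A₁] [MeasurableSpace A₂] [MeasurableSpace S₁] [MeasurableSpace S₂]
  [DiscreteMeasurableSpace A₁] [DiscreteMeasurableSpace A₂]
  [DiscreteMeasurableSpace S₁] [DiscreteMeasurableSpace S₂]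

/-- In a truncated game both players have optimal strategies. -/
lemma exists_saddle_truncate [Nonempty A₁] [Nonempty A₂] (G : Game A₁ A₂ S₁ S₂) (n : ℕ) :
    ∃ (v : ℝ≥0∞) (σ : Strategy A₁ S₁) (τ : Strategy A₂ S₂),
      v ≤ (G.truncate n).val₁ σ ∧ (G.truncate n).val₂ τ ≤ v := by
  have := G.nonempty_signal₁
  have := G.nonempty_signal₂
  obtain ⟨w, hw, v, hv, h⟩ := G.exists_saddle_planSum n
  obtain ⟨σ, rfl⟩ := exists_weight_eq hv
  obtain ⟨τ, rfl⟩ := exists_weight_eq hw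
  refine ⟨(G.truncate n).expectedPayoff σ τ, σ, τ, le_iInf fun τ' => ?_, iSup_le fun σ' => ?_⟩
  · simp only [expectedPayoff_truncate]
    exact ENNReal.ofReal_le_ofReal (h _ (weight_mem_plans τ') _ hv)
  · simp only [expectedPayoff_truncate]
    exact ENNReal.ofReal_le_ofReal (h _ hw _ (weight_mem_plans σ'))

/-- If the Minimizer can guarantee `v` in every truncated game, then a single strategy
guarantees `v` in all of them. -/
lemma exists_uniform_strategy₂ [Nonempty A₁] [Nonempty A₂] (G : Game A₁ A₂ S₁ S₂) {v : ℝ≥0∞}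
    (hv : v ≠ ∞) (h : ∀ n, ∃ τ, (G.truncate n).val₂ τ ≤ v) :
    ∃ τ, ∀ n, (G.truncate n).val₂ τ ≤ v := by
  have := G.nonempty_signal₂
  have key (n : ℕ) (τ : Strategy A₂ S₂) : (G.truncate n).val₂ τ ≤ v ↔
      ∀ σ, G.planSum n (weight σ) (weight τ) ≤ v.toReal := by
    simp only [val₂, iSup_le_iff, expectedPayoff_truncate, ENNReal.ofReal_le_iff_le_toReal hv]
  simp only [key] at h ⊢
  -- The plans that guarantee `v` in the `n`-th truncation. They decrease with `n` because further
  -- payoffs are nonnegative, so Cantor's intersection theorem applies.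
  let t (n : ℕ) : Set ((n : ℕ) → (Fin n → A₂ × S₂) → ℝ) :=
    plans A₂ S₂ ∩ ⋂ σ : Strategy A₁ S₁, {w | G.planSum n (weight σ) w ≤ v.toReal}
  have hcl (n : ℕ) : IsClosed (t n) := isClosed_plans.inter <| isClosed_iInter fun σ =>
    isClosed_le (G.continuous_planSum_right n _) continuous_const
  have ht (n : ℕ) (w : (n : ℕ) → (Fin n → A₂ × S₂) → ℝ) : w ∈ t n ↔
      w ∈ plans A₂ S₂ ∧ ∀ σ : Strategy A₁ S₁, G.planSum n (weight σ) w ≤ v.toReal := by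
    simp [t]
  have hanti (n : ℕ) : t (n + 1) ⊆ t n := by
    intro w hw
    rw [ht] at hw ⊢
    refine ⟨hw.1, fun σ => le_trans ?_ (hw.2 σ)⟩
    simp only [planSum]
    rw [Finset.sum_range_succ _ (n + 1)]
    exact le_add_of_nonneg_right (G.planPayoff_nonneg _ (weight_mem_plans σ) hw.1)
  have hne (n : ℕ) : (t n).Nonempty := by
    obtain ⟨τ, hτ⟩ := h n
    exact ⟨weight τ, (ht _ _).2 ⟨weight_mem_plans τ, hτ⟩⟩
  obtain ⟨w, hw⟩ := IsCompact.nonempty_iInter_of_sequence_nonempty_isCompact_isClosed t hanti hne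
    (isCompact_plans.of_isClosed_subset (hcl 0) Set.inter_subset_left) hcl
  simp only [Set.mem_iInter, ht] at hw
  obtain ⟨τ, rfl⟩ := exists_weight_eq (hw 0).1
  exact ⟨τ, fun n σ => (hw n).2 σ⟩

lemma expectedPayoff_truncate_le (G : Game A₁ A₂ S₁ S₂) (n : ℕ) (σ : Strategy A₁ S₁)
    (τ : Strategy A₂ S₂) : (G.truncate n).expectedPayoff σ τ ≤ G.expectedPayoff σ τ := by
  rw [G.expectedPayoff_eq_iSup]
  exact le_iSup (fun n => (G.truncate n).expectedPayoff σ τ) n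

lemma val₁_truncate_mono (G : Game A₁ A₂ S₁ S₂) (σ : Strategy A₁ S₁) :
    Monotone fun n => (G.truncate n).val₁ σ :=
  fun _ _ hmn => iInf_mono fun τ => G.expectedPayoff_truncate_mono σ τ hmn

lemma val₁_truncate_le (G : Game A₁ A₂ S₁ S₂) (n : ℕ) (σ : Strategy A₁ S₁) :
    (G.truncate n).val₁ σ ≤ G.val₁ σ :=
  iInf_mono fun τ => G.expectedPayoff_truncate_le n σ τ

/-- Two suprema commute. For `val₁` an infimum meets a supremum, and only the inequality
`val₁_truncate_le` is used. -/
lemma val₂_eq_iSup_truncate (G : Game A₁ A₂ S₁ S₂) (τ : Strategy A₂ S₂) :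
    G.val₂ τ = ⨆ n, (G.truncate n).val₂ τ := by
  simp only [val₂, G.expectedPayoff_eq_iSup]
  exact iSup_comm

lemma lowerValue_le_of_totalPayoff_lt [Nonempty A₂] (G : Game A₁ A₂ S₁ S₂) {B : ℝ≥0}
    (hB : ∀ h, G.totalPayoff h < B) : G.lowerValue ≤ B :=
  iSup_le fun σ => (iInf_le _ fun _ _ => PMF.pure (Classical.arbitrary A₂)).trans
    (G.expectedPayoff_le_of_totalPayoff_lt hB σ _)

end Minimax

end Game

end PursuitEvasion

end

/-! ### The uniform value -/

theorem theorem1 {A₁ A₂ S₁ S₂ : Type*}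
    [Finite A₁] [Finite A₂] [Finite S₁] [Finite S₂] [Nonempty A₁] [Nonempty A₂]
    [MeasurableSpace A₁] [MeasurableSpace A₂] [MeasurableSpace S₁] [MeasurableSpace S₂]
    [DiscreteMeasurableSpace A₁] [DiscreteMeasurableSpace A₂]
    [DiscreteMeasurableSpace S₁] [DiscreteMeasurableSpace S₂]
    (G : PursuitEvasion.Game A₁ A₂ S₁ S₂) (hG : G.Bounded) :
    G.HasUniformValue ∧ ∃ τ : PursuitEvasion.Strategy A₂ S₂, G.IsOptimal₂ τ := by
  cases nonempty_fintype A₁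
  cases nonempty_fintype A₂
  cases nonempty_fintype S₁
  cases nonempty_fintype S₂
  obtain ⟨B, hB⟩ := hG
  choose u σ τ' hσ hτ' using G.exists_saddle_truncate
  have hu (n : ℕ) : (G.truncate n).IsValue (u n) :=
    (G.truncate n).isValue_of_le ((hσ n).trans (PursuitEvasion.Game.val₁_le_lowerValue _ _))
      ((PursuitEvasion.Game.upperValue_le_val₂ _ _).trans (hτ' n))
  set v := ⨆ n, u n with hv
  have hlow : v ≤ G.lowerValue := iSup_le fun n =>
    (hσ n).trans ((G.val₁_truncate_le n (σ n)).trans (G.val₁_le_lowerValue _))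
  have hfin : v ≠ ⊤ :=
    ((hlow.trans (G.lowerValue_le_of_totalPayoff_lt hB)).trans_lt ENNReal.coe_lt_top).ne
  obtain ⟨τ, hτ⟩ := G.exists_uniform_strategy₂ hfin fun n => ⟨τ' n, (hτ' n).trans (le_iSup u n)⟩
  have hτG : G.val₂ τ ≤ v := (G.val₂_eq_iSup_truncate τ).trans_le (iSup_le hτ)
  have hval : G.IsValue v := G.isValue_of_le hlow ((G.upperValue_le_val₂ τ).trans hτG)
  have hopt : G.val₂ τ = v := hτG.antisymm (hval.2.symm.trans_le (G.upperValue_le_val₂ τ))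
  refine ⟨⟨⟨v, hval⟩, fun ε hε => ?_⟩, τ, (congrArg G.IsValue hopt).mpr hval⟩
  have hε' : (ε : ENNReal) ≠ 0 := by simpa using hε.ne'
  -- Otherwise `v + ε ≤ v`, which is impossible for finite `v`.
  obtain ⟨N, hN⟩ : ∃ N, v < u N + ε := by
    by_contra! hcon
    exact (ENNReal.lt_add_right hfin hε').not_ge
      ((ENNReal.iSup_add u).trans_le (iSup_le hcon))
  refine ⟨N, σ N, τ, fun n hn => ⟨⟨u n, hu n, ?_, ?_⟩, ⟨u n, hu n, ?_, ?_⟩⟩⟩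
  -- For `n > N`, `u N ≤ val₁ (σ N) ≤ u n ≤ val₂ τ ≤ v < u N + ε`, with both values taken in the
  -- `n`-th truncation; all four bounds follow.
  all_goals have hun : u n ≤ v := le_iSup u n
  all_goals have hNn : u N ≤ (G.truncate n).val₁ (σ N) :=
    (hσ N).trans (G.val₁_truncate_mono (σ N) hn.le)
  all_goals have hn₁ : (G.truncate n).val₁ (σ N) ≤ u n :=
    ((G.truncate n).val₁_le_lowerValue _).trans_eq (hu n).1
  all_goals have hn₂ : u n ≤ (G.truncate n).val₂ τ :=
    (hu n).2.symm.trans_le ((G.truncate n).upperValue_le_val₂ τ)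
  · exact hn₁.trans_lt (ENNReal.lt_add_right (hun.trans_lt hfin.lt_top).ne hε')
  · exact (hun.trans_lt hN).trans_le (add_le_add_left hNn _)
  · exact ((hτ n).trans_lt hN).trans_le (add_le_add_left (hNn.trans hn₁) _)
  · exact hn₂.trans_lt (ENNReal.lt_add_right ((hτ n).trans_lt hfin.lt_top).ne hε')
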